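/- Let $n\in\mathbb{N}$ and let $\mu$ be a finite positive Borel measure on $\mathbb{R}^n$. For $i=1,\dots,n$ and $k\ge 1$ put $y_{i,2k}:=\int_{\mathbb{R}^n}x_i^{2k}\,d\mu(x)\in[0,+\infty]$, and suppose that $\mu$ satisfies the multivariate Carleman condition $$\sum_{k=1}^{\infty}y_{i,2k}^{-1/(2k)}=+\infty\qquad\text{for each } i=1,\dots,n,$$ with the conventions $(+\infty)^{-1/(2k)}=0$ and $0^{-1/(2k)}=+\infty$. Then every polynomial $p\in\mathbb{R}[x_1,\dots,x_n]$ belongs to the real Hilbert space $L^2(\mu)$, and polynomials are dense in $L^2(\mu)$. Equivalently, for every $f\in L^2(\mu)$ and every $\varepsilon>0$ there exists a polynomial $p\in\mathbb{R}[x_1,\dots,x_n]$ such that $\|f-p\|_{L^2(\mu)}<\varepsilon$. -/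

import Mathlib

open MeasureTheory
open scoped ENNReal

/-- The even marginal moment `∫ x_i ^ (2k) dμ` of a measure on `ℝⁿ`, with value in `[0, ∞]`. -/
noncomputable def evenMarginalMoment {n : ℕ} (μ : Measure (Fin n → ℝ)) (i : Fin n) (k : ℕ) :
    ℝ≥0∞ :=
  ∫⁻ x, ENNReal.ofReal (x i ^ (2 * k)) ∂μ

/-- The multivariate Carleman condition: for each coordinate `i`, the series
`∑_{k ≥ 1} (∫ x_i ^ (2k) dμ) ^ (-1 / (2k))` diverges to `+∞`. The series is taken in `[0, ∞]`,
where a negative power of `+∞` is `0` and a negative power of `0` is `+∞`. The summation index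
is shifted so that it starts at `1`. -/
def SatisfiesCarleman {n : ℕ} (μ : Measure (Fin n → ℝ)) : Prop :=
  ∀ i : Fin n,
    ∑' k : ℕ, evenMarginalMoment μ i (k + 1) ^ (-(1 / (2 * ((k + 1 : ℕ) : ℝ)))) = ∞

/-- The elements of `L²(μ)` that are classes of real polynomial functions on `ℝⁿ`. -/
def polynomialsInL2 {n : ℕ} (μ : Measure (Fin n → ℝ)) : Set (Lp ℝ 2 μ) :=
  {F | ∃ p : MvPolynomial (Fin n) ℝ, F =ᵐ[μ] fun x => MvPolynomial.eval x p}

/-!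
By duality in the Hilbert space `L²(μ)`, it is enough that a square integrable `f` orthogonal to
all polynomials is zero, and for this it is enough that the Fourier transform of the signed measure
`f μ` vanishes: the positive and negative parts of `f` are then densities of the same measure
(`ae_eq_zero_of_forall_integral_exp_eq_zero`).

The Fourier transform is reached one coordinate at a time (`integral_mul_eval_mul_exp_eq_zero`). If
`∫ f p exp (i ∑_{j ∈ S} t_j x_j) dμ = 0` for all polynomials `p`, then for a further coordinate `x_i`
the function `φ(s) = ∫ f p exp (i ∑_{j ∈ S} t_j x_j) exp (i s x_i) dμ` has all its derivatives zero
at `s = 0`. Two applications of the Cauchy–Schwarz inequality bound its `k`-th derivative by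
`M k = C (∫ x_i ^ (4k) dμ) ^ (1/4)`, where `C` depends on `f` and `p`. This sequence is log-convex,
and `∑ M k / M (k + 1) = ∞` follows from the Carleman condition by Carleman's inequality for
geometric means (`summable_geomMean_of_summable`). So `φ = 0` by the Denjoy–Carleman theorem. A
coordinate that vanishes almost everywhere has zero moments and is treated apart: there the factor
`exp (i s x_i)` is `1`.

The Denjoy–Carleman theorem is proved by Bang's method (`bang_step`, `denjoy_carleman`). Say that
`φ` is small of order `N` at `t` if `|φ⁽ʲ⁾(t)| ≤ e ^ (j - N) M j` for all `j`. At `0` this holds for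
every `N`. By Taylor's formula, moving by at most `M n / (e M (n + 1))` lowers the order from
`n + 1` to `n` only; the sum of these step lengths diverges, so `φ` is small of every order at
every point.
-/

/-! ### Divergent series -/

/-- **Carleman's inequality**, in qualitative form. The constant obtained is `2e`: apply the
inequality of arithmetic and geometric means to the numbers `(i + 1) * a i`, and use
`N! ≥ (N / e) ^ N`. -/
theorem summable_geomMean_of_summable {a : ℕ → ℝ} (ha : ∀ k, 0 ≤ a k) (hs : Summable a) :
    Summable fun k : ℕ => (∏ i ∈ Finset.range (k + 1), a i) ^ (1 / ((k + 1 : ℕ) : ℝ)) := by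
  set T : ℕ → ℝ := fun n => ∑ i ∈ Finset.range n, ((i + 1 : ℕ) : ℝ) * a i with hT
  have hT0 : ∀ n, 0 ≤ T n := fun n => Finset.sum_nonneg fun i _ => by have := ha i; positivity
  have hP : ∀ n, 0 ≤ ∏ i ∈ Finset.range n, a i := fun n => Finset.prod_nonneg fun i _ => ha i
  have key : ∀ k : ℕ, (∏ i ∈ Finset.range (k + 1), a i) ^ (1 / ((k + 1 : ℕ) : ℝ)) ≤
      Real.exp 1 * (T (k + 1) / ((k + 1 : ℕ) : ℝ) ^ 2) := by
    intro k
    set N : ℝ := ((k + 1 : ℕ) : ℝ) with hN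
    have hN0 : 0 < N := by positivity
    have amgm := Real.geom_mean_le_arith_mean_weighted (Finset.range (k + 1))
      (fun _ => 1 / N) (fun i => ((i + 1 : ℕ) : ℝ) * a i) (fun _ _ => by positivity)
      (by simp [hN]; field_simp) (fun i _ => by have := ha i; positivity)
    rw [Real.finsetProd_rpow _ _ (fun i _ => by have := ha i; positivity),
      Finset.prod_mul_distrib, ← Finset.mul_sum] at amgm
    have hfac : ∏ i ∈ Finset.range (k + 1), ((i + 1 : ℕ) : ℝ) = ((k + 1).factorial : ℝ) := by
      rw [← Nat.cast_prod, Finset.prod_range_add_one_eq_factorial]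
    rw [hfac] at amgm
    have hst : (N / Real.exp 1) ^ (k + 1) ≤ ((k + 1).factorial : ℝ) := by
      have h := Real.pow_div_factorial_le_exp N hN0.le (k + 1)
      rw [div_le_iff₀ (by positivity)] at h
      rw [div_pow, div_le_iff₀ (by positivity), ← Real.exp_nat_mul, mul_one, mul_comm]
      exact h
    have h1 : N / Real.exp 1 * (∏ i ∈ Finset.range (k + 1), a i) ^ (1 / N) ≤ 1 / N * T (k + 1) := by
      refine le_trans ?_ amgm
      rw [Real.mul_rpow (by positivity) (hP _)]
      refine mul_le_mul_of_nonneg_right ?_ (Real.rpow_nonneg (hP _) _)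
      calc N / Real.exp 1 = ((N / Real.exp 1) ^ (k + 1)) ^ (1 / N) := by
            rw [← Real.rpow_natCast, ← Real.rpow_mul (by positivity)]
            rw [← hN, mul_one_div_cancel hN0.ne', Real.rpow_one]
        _ ≤ _ := Real.rpow_le_rpow (by positivity) hst (by positivity)
    rw [div_mul_eq_mul_div, div_le_iff₀ (by positivity)] at h1
    calc (∏ i ∈ Finset.range (k + 1), a i) ^ (1 / N)
        = N * (∏ i ∈ Finset.range (k + 1), a i) ^ (1 / N) / N := by field_simp
      _ ≤ (1 / N * T (k + 1) * Real.exp 1) / N := by gcongr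
      _ = _ := by field_simp
  -- The partial sums of `T (k + 1) / (k + 1) ^ 2` telescope, since
  -- `1 / (n + 1) ^ 2 ≤ 1 / n - 1 / (n + 1)` for `n ≥ 1`; for `n = 0` the term `T n / n` is `0 / 0 = 0`.
  have tele : ∀ n : ℕ, ∑ k ∈ Finset.range n, T (k + 1) / ((k + 1 : ℕ) : ℝ) ^ 2 ≤
      2 * ∑ i ∈ Finset.range n, a i - T n / n := by
    intro n
    induction n with
    | zero => simp
    | succ n ih =>
      rw [Finset.sum_range_succ, Finset.sum_range_succ _ n]
      have hTn : T (n + 1) = T n + ((n + 1 : ℕ) : ℝ) * a n := by simp [hT, Finset.sum_range_succ]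
      have h2 : T n / ((n + 1 : ℕ) : ℝ) ^ 2 + T n / ((n + 1 : ℕ) : ℝ) ≤ T n / n := by
        rcases Nat.eq_zero_or_pos n with rfl | hn
        · simp [hT]
        · have hn' : (0 : ℝ) < n := by exact_mod_cast hn
          have : (1 : ℝ) / ((n + 1 : ℕ) : ℝ) ^ 2 + 1 / ((n + 1 : ℕ) : ℝ) ≤ 1 / n := by
            push_cast
            rw [div_add_div _ _ (by positivity) (by positivity),
              div_le_div_iff₀ (by positivity) (by positivity)]
            nlinarith [mul_pos hn' hn']
          have := mul_le_mul_of_nonneg_left this (hT0 n)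
          rwa [mul_add, mul_one_div, mul_one_div, mul_one_div] at this
      have h3 : ((n + 1 : ℕ) : ℝ) * a n / ((n + 1 : ℕ) : ℝ) ^ 2 ≤ a n := by
        have h1 : (1 : ℝ) ≤ ((n + 1 : ℕ) : ℝ) := by push_cast; linarith [n.cast_nonneg (α := ℝ)]
        rw [div_le_iff₀ (by positivity)]
        have := mul_le_mul_of_nonneg_right h1 (ha n)
        nlinarith
      have h4 : ((n + 1 : ℕ) : ℝ) * a n / ((n + 1 : ℕ) : ℝ) = a n := by field_simp
      rw [hTn, add_div, add_div, h4]
      linarith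
  refine summable_of_sum_range_le (c := Real.exp 1 * (2 * ∑' i, a i))
    (fun k => Real.rpow_nonneg (hP _) _) fun n => ?_
  refine (Finset.sum_le_sum fun k _ => key k).trans ?_
  rw [← Finset.mul_sum]
  refine mul_le_mul_of_nonneg_left ((tele n).trans ?_) (Real.exp_pos 1).le
  have := hs.sum_le_tsum (Finset.range n) fun i _ => ha i
  have h5 : 0 ≤ T n / n := div_nonneg (hT0 n) n.cast_nonneg
  linarith

/-- An antitone nonnegative sequence is summable as soon as its odd-indexed terms are. -/
theorem summable_of_antitone_of_summable_odd {s : ℕ → ℝ} (h0 : ∀ k, 0 ≤ s k) (hs : Antitone s)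
    (h : Summable fun k => s (2 * k + 1)) : Summable s := by
  have heven : Summable fun k => s (2 * k) := by
    rw [← summable_nat_add_iff 1]
    exact h.of_nonneg_of_le (fun k => h0 _) fun k => hs (by omega)
  exact (heven.hasSum.even_add_odd h.hasSum).summable

/-- A positive sequence `y` with `∑ y (k + 1) ^ (-1 / (2 (k + 1))) = ∞` also satisfies
`∑ √(y k / y (k + 1)) = ∞`: the terms of the first series are, up to a bounded factor, the
geometric means of the terms of the second. -/
theorem not_summable_sqrt_ratio {y : ℕ → ℝ} (hy : ∀ k, 0 < y k)
    (hC : ¬ Summable fun k : ℕ => y (k + 1) ^ (-(1 / (2 * ((k + 1 : ℕ) : ℝ))))) :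
    ¬ Summable fun k => √(y k / y (k + 1)) := by
  intro hs
  apply hC
  have hs' := summable_geomMean_of_summable (fun k => Real.sqrt_nonneg _) hs
  have hprod : ∀ n, ∏ i ∈ Finset.range n, √(y i / y (i + 1)) = √(y 0 / y n) := by
    intro n
    induction n with
    | zero => simp [(hy 0).ne']
    | succ n ih =>
      rw [Finset.prod_range_succ, ih, ← Real.sqrt_mul (div_pos (hy _) (hy _)).le]
      congr 1
      have := (hy n).ne'
      field_simp
  refine (hs'.mul_left (min 1 (y 0))⁻¹).of_nonneg_of_le
    (fun k => Real.rpow_nonneg (hy _).le _) fun k => ?_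
  have hc : 0 < min 1 (y 0) := lt_min one_pos (hy 0)
  rw [inv_mul_eq_div, le_div_iff₀ hc, hprod, Real.sqrt_eq_rpow,
    ← Real.rpow_mul (div_pos (hy _) (hy _)).le, Real.div_rpow (hy _).le (hy _).le,
    Real.rpow_neg (hy _).le]
  have he : 1 / 2 * (1 / ((k + 1 : ℕ) : ℝ)) = 1 / (2 * ((k + 1 : ℕ) : ℝ)) := by field_simp
  rw [he, div_eq_inv_mul (y 0 ^ _)]
  refine mul_le_mul_of_nonneg_left ?_ (inv_nonneg.2 (Real.rpow_nonneg (hy _).le _))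
  have hk : (1 : ℝ) ≤ ((k + 1 : ℕ) : ℝ) := by push_cast; linarith [k.cast_nonneg (α := ℝ)]
  calc min 1 (y 0) = min 1 (y 0) ^ (1 : ℝ) := (Real.rpow_one _).symm
    _ ≤ min 1 (y 0) ^ (1 / (2 * ((k + 1 : ℕ) : ℝ))) :=
        Real.rpow_le_rpow_of_exponent_ge hc (min_le_left _ _)
          (by rw [div_le_one (by positivity)]; linarith)
    _ ≤ _ := Real.rpow_le_rpow hc.le (min_le_right _ _) (by positivity)

/-- Fourth roots of ratios with even indices, as geometric means of two consecutive square roots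
of ratios. -/
theorem sqrt_sqrt_ratio {y : ℕ → ℝ} (hy : ∀ k, 0 < y k) (k : ℕ) :
    √√(y (2 * k)) / √√(y (2 * (k + 1))) =
      √(√(y (2 * k) / y (2 * k + 1)) * √(y (2 * k + 1) / y (2 * k + 1 + 1))) := by
  rw [← Real.sqrt_mul (div_pos (hy _) (hy _)).le,
    div_mul_div_cancel₀ (hy _).ne', Real.sqrt_div (hy _).le, Real.sqrt_div (Real.sqrt_nonneg _)]
  rfl

theorem antitone_sqrt_sqrt_ratio {y : ℕ → ℝ} (hy : ∀ k, 0 < y k)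
    (ha : Antitone fun k => y k / y (k + 1)) :
    Antitone fun k => √√(y (2 * k)) / √√(y (2 * (k + 1))) := by
  intro k l hkl
  simp only [sqrt_sqrt_ratio hy]
  have h1 : √(y (2 * l) / y (2 * l + 1)) ≤ √(y (2 * k) / y (2 * k + 1)) :=
    Real.sqrt_le_sqrt (ha (show 2 * k ≤ 2 * l by omega))
  have h2 : √(y (2 * l + 1) / y (2 * l + 1 + 1)) ≤ √(y (2 * k + 1) / y (2 * k + 1 + 1)) :=
    Real.sqrt_le_sqrt (ha (show 2 * k + 1 ≤ 2 * l + 1 by omega))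
  gcongr

/-- Passing from the sequence `y k` to its even-indexed terms preserves divergence. -/
theorem not_summable_sqrt_sqrt_ratio {y : ℕ → ℝ} (hy : ∀ k, 0 < y k)
    (ha : Antitone fun k => y k / y (k + 1))
    (h : ¬ Summable fun k => √(y k / y (k + 1))) :
    ¬ Summable fun k => √√(y (2 * k)) / √√(y (2 * (k + 1))) := by
  intro hs
  apply h
  have hanti : Antitone fun k => √(y k / y (k + 1)) := fun k l hkl => Real.sqrt_le_sqrt (ha hkl)
  refine summable_of_antitone_of_summable_odd (fun k => Real.sqrt_nonneg _) hanti ?_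
  refine hs.of_nonneg_of_le (fun k => Real.sqrt_nonneg _) fun k => ?_
  rw [sqrt_sqrt_ratio hy]
  refine Real.le_sqrt_of_sq_le ?_
  rw [sq]
  exact mul_le_mul_of_nonneg_right (hanti (Nat.le_succ _)) (Real.sqrt_nonneg _)

/-! ### Quasi-analyticity -/

/-- The Taylor remainder of `exp` along an imaginary ray. -/
theorem norm_exp_sub_sum_le_of_re_eq_zero {w : ℂ} (hw : ‖w‖ = 1) (hre : w.re = 0) (m : ℕ) :
    ∀ t : ℝ, 0 ≤ t → ‖Complex.exp (t * w) - ∑ l ∈ Finset.range m, (t * w) ^ l / (l.factorial : ℂ)‖ ≤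
      t ^ m / (m.factorial : ℝ) := by
  induction m with
  | zero =>
    intro t _
    simp [Complex.norm_exp, hre]
  | succ m ih =>
    intro t ht
    have hd : ∀ x : ℝ, HasDerivAt (fun x : ℝ => Complex.exp (x * w) -
        ∑ l ∈ Finset.range (m + 1), (x * w) ^ l / (l.factorial : ℂ))
        (w * (Complex.exp (x * w) - ∑ l ∈ Finset.range m, (x * w) ^ l / (l.factorial : ℂ))) x := by
      intro x
      have hx : HasDerivAt (fun x : ℝ => (x : ℂ) * w) w x := by
        simpa using (Complex.ofRealCLM.hasDerivAt (x := x)).mul_const w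
      have hsum : HasDerivAt (fun x : ℝ => ∑ l ∈ Finset.range (m + 1),
          ((x : ℂ) * w) ^ l / (l.factorial : ℂ))
          (∑ l ∈ Finset.range (m + 1), (l * ((x : ℂ) * w) ^ (l - 1) * w) / (l.factorial : ℂ)) x :=
        HasDerivAt.fun_sum fun l _ => (hx.pow l).div_const _
      refine (hx.cexp.sub hsum).congr_deriv ?_
      rw [Finset.sum_range_succ', mul_sub, Finset.mul_sum]
      simp only [Nat.cast_zero, zero_mul, zero_div, add_zero]
      rw [mul_comm w]
      congr 1
      refine Finset.sum_congr rfl fun l _ => ?_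
      rw [Nat.factorial_succ]
      have h1 : ((l.factorial : ℕ) : ℂ) ≠ 0 := by exact_mod_cast l.factorial_ne_zero
      have h2 : ((l + 1 : ℕ) : ℂ) ≠ 0 := by exact_mod_cast l.succ_ne_zero
      rw [Nat.cast_mul, Nat.add_sub_cancel]
      field_simp
    refine image_norm_le_of_norm_deriv_right_le_deriv_boundary
      (fun x _ => (hd x).continuousAt.continuousWithinAt)
      (fun x _ => (hd x).hasDerivWithinAt) (a := 0) (b := t)
      (B := fun x => x ^ (m + 1) / ((m + 1).factorial : ℝ)) (B' := fun x => x ^ m / (m.factorial : ℝ))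
      ?_ ?_ ?_ ⟨ht, le_rfl⟩
    · simp [Finset.sum_range_succ']
    · intro x
      refine ((hasDerivAt_pow (m + 1) x).div_const _).congr_deriv ?_
      rw [Nat.factorial_succ]
      push_cast
      have : (m.factorial : ℝ) ≠ 0 := by positivity
      field_simp
    · intro x hx
      rw [norm_mul, hw, one_mul]
      exact ih x hx.1

theorem norm_exp_mul_I_sub_sum_le (u : ℝ) (m : ℕ) :
    ‖Complex.exp (u * Complex.I) -
      ∑ l ∈ Finset.range m, (u * Complex.I) ^ l / (l.factorial : ℂ)‖ ≤
      |u| ^ m / (m.factorial : ℝ) := by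
  rcases le_total 0 u with h | h
  · rw [abs_of_nonneg h]
    exact norm_exp_sub_sum_le_of_re_eq_zero (by simp) (by simp) m u h
  · rw [abs_of_nonpos h]
    simpa using norm_exp_sub_sum_le_of_re_eq_zero (w := -Complex.I) (by simp) (by simp) m (-u)
      (by linarith)

/-- **Bang's propagation estimate.** Here `φ j` plays the role of the `j`-th derivative of `φ 0`.
If `‖φ j t‖ ≤ e ^ (j - N) * M j` for all `j` with `N = n + 1`, then the same bound with `N = n`
holds at all points at distance at most `M n / (e * M (n + 1))` from `t`. For `j ≥ n` it is the
a priori bound `M j`, and for `j < n` it follows from Taylor's formula of order `n + 1 - j`. -/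
theorem bang_step {φ : ℕ → ℝ → ℂ} {M : ℕ → ℝ} (hM : ∀ k, 0 < M k)
    (hanti : Antitone fun k => M k / M (k + 1))
    (hbound : ∀ j t, ‖φ j t‖ ≤ M j)
    (htaylor : ∀ j m t τ, ‖φ j (t + τ) -
      ∑ l ∈ Finset.range m, (τ : ℂ) ^ l / (l.factorial : ℂ) * φ (j + l) t‖ ≤
      |τ| ^ m / (m.factorial : ℝ) * M (j + m))
    (n : ℕ) (t τ : ℝ) (hτ : |τ| ≤ M n / M (n + 1) / Real.exp 1)
    (h : ∀ j : ℕ, ‖φ j t‖ ≤ Real.exp (j - (n + 1 : ℕ)) * M j) :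
    ∀ j : ℕ, ‖φ j (t + τ)‖ ≤ Real.exp (j - n) * M j := by
  intro j
  rcases le_or_gt n j with hj | hj
  · refine (hbound _ _).trans (le_mul_of_one_le_left (hM j).le (Real.one_le_exp ?_))
    rw [sub_nonneg]; exact_mod_cast hj
  obtain ⟨m, hm⟩ : ∃ m, j + m = n + 1 := ⟨n + 1 - j, by omega⟩
  set ρ := M (n + 1) / M n with hρ
  have hρ0 : 0 < ρ := div_pos (hM _) (hM _)
  have hgrow : ∀ l, j + l ≤ n + 1 → M (j + l) ≤ M j * ρ ^ l := by
    intro l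
    induction l with
    | zero => intro _; simp
    | succ l ih =>
      intro hl
      have h1 := hanti (show j + l ≤ n by omega)
      have h2 : M (j + l + 1) ≤ M (j + l) * ρ := by
        beta_reduce at h1
        rw [div_le_div_iff₀ (hM _) (hM _)] at h1
        rw [hρ, mul_div_assoc', le_div_iff₀ (hM _)]
        linarith
      calc M (j + (l + 1)) ≤ M (j + l) * ρ := h2
        _ ≤ M j * ρ ^ l * ρ := mul_le_mul_of_nonneg_right (ih (by omega)) hρ0.le
        _ = _ := by ring
  set E := Real.exp (j - (n + 1 : ℕ)) with hE
  have hterm : ∀ l, j + l ≤ n + 1 →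
      |τ| ^ l / (l.factorial : ℝ) * (Real.exp ((j + l : ℕ) - (n + 1 : ℕ)) * M (j + l)) ≤
      E * M j * ((Real.exp 1 * |τ| * ρ) ^ l / (l.factorial : ℝ)) := by
    intro l hl
    have : Real.exp ((j + l : ℕ) - (n + 1 : ℕ)) = E * Real.exp 1 ^ l := by
      rw [hE, ← Real.exp_nat_mul, ← Real.exp_add]; push_cast; ring_nf
    rw [this]
    calc _ ≤ |τ| ^ l / (l.factorial : ℝ) * (E * Real.exp 1 ^ l * (M j * ρ ^ l)) := by
          gcongr; exact hgrow l hl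
      _ = _ := by ring
  have hu : Real.exp 1 * |τ| * ρ ≤ 1 := by
    rw [hρ]
    have := hM n
    have := hM (n + 1)
    calc Real.exp 1 * |τ| * (M (n + 1) / M n)
        ≤ Real.exp 1 * (M n / M (n + 1) / Real.exp 1) * (M (n + 1) / M n) := by gcongr
      _ = 1 := by field_simp
  have hu0 : 0 ≤ Real.exp 1 * |τ| * ρ := by positivity
  have hrem : ‖φ j (t + τ) -
      ∑ l ∈ Finset.range m, (τ : ℂ) ^ l / (l.factorial : ℂ) * φ (j + l) t‖ ≤
      E * M j * ((Real.exp 1 * |τ| * ρ) ^ m / (m.factorial : ℝ)) := by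
    refine (htaylor j m t τ).trans (le_trans (le_of_eq ?_) (hterm m hm.le))
    rw [hm, sub_self, Real.exp_zero, one_mul]
  have hsum : ‖∑ l ∈ Finset.range m, (τ : ℂ) ^ l / (l.factorial : ℂ) * φ (j + l) t‖ ≤
      ∑ l ∈ Finset.range m, E * M j * ((Real.exp 1 * |τ| * ρ) ^ l / (l.factorial : ℝ)) := by
    refine norm_sum_le_of_le _ fun l hl => ?_
    have hl' := Finset.mem_range.1 hl
    refine le_trans ?_ (hterm l (by omega))
    rw [norm_mul, norm_div, norm_pow, Complex.norm_real, Complex.norm_natCast, Real.norm_eq_abs]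
    exact mul_le_mul_of_nonneg_left (h (j + l)) (by positivity)
  have htot : ‖φ j (t + τ)‖ ≤
      E * M j * ∑ l ∈ Finset.range (m + 1), (Real.exp 1 * |τ| * ρ) ^ l / (l.factorial : ℝ) := by
    rw [Finset.sum_range_succ, mul_add, Finset.mul_sum]
    have := norm_sub_norm_le (φ j (t + τ))
      (∑ l ∈ Finset.range m, (τ : ℂ) ^ l / (l.factorial : ℂ) * φ (j + l) t)
    linarith
  have hEM : 0 ≤ E * M j := mul_nonneg (Real.exp_pos _).le (hM j).le
  calc ‖φ j (t + τ)‖ ≤ E * M j * Real.exp 1 := htot.trans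
        (mul_le_mul_of_nonneg_left ((Real.sum_le_exp_of_nonneg hu0 _).trans
          (Real.exp_le_exp.2 hu)) hEM)
    _ = Real.exp (j - n) * M j := by
        rw [mul_right_comm, hE, ← Real.exp_add]; push_cast; ring_nf

/-- **Denjoy–Carleman theorem**, for log-convex bounds: a function all of whose derivatives vanish
at `0`, with the `j`-th derivative bounded by `M j` where `∑ M k / M (k + 1) = ∞`, is zero. The
derivatives `φ j` enter only through the bounds and Taylor's formula. -/
theorem denjoy_carleman {φ : ℕ → ℝ → ℂ} {M : ℕ → ℝ} (hM : ∀ k, 0 < M k)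
    (hanti : Antitone fun k => M k / M (k + 1))
    (hdiv : ¬ Summable fun k => M k / M (k + 1))
    (hbound : ∀ j t, ‖φ j t‖ ≤ M j)
    (htaylor : ∀ j m t τ, ‖φ j (t + τ) -
      ∑ l ∈ Finset.range m, (τ : ℂ) ^ l / (l.factorial : ℂ) * φ (j + l) t‖ ≤
      |τ| ^ m / (m.factorial : ℝ) * M (j + m))
    (hzero : ∀ j, φ j 0 = 0) (t : ℝ) : φ 0 t = 0 := by
  set a : ℕ → ℝ := fun k => M k / M (k + 1) / Real.exp 1 with ha
  have ha0 : ∀ k, 0 ≤ a k := fun k => by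
    have := hM k; have := hM (k + 1); positivity
  have hdiva : ¬ Summable a := by
    intro hs
    apply hdiv
    refine (hs.mul_right (Real.exp 1)).congr fun k => ?_
    simp [ha, Real.exp_ne_zero]
  -- Chaining `d` propagation steps, the order of vanishing drops from `n + d` to `n`.
  have chain : ∀ d n : ℕ, ∀ t : ℝ, |t| ≤ ∑ k ∈ Finset.range d, a (n + k) →
      ∀ j : ℕ, ‖φ j t‖ ≤ Real.exp (j - n) * M j := by
    intro d
    induction d with
    | zero =>
      intro n t ht j
      have : t = 0 := by simpa using ht
      rw [this, hzero, norm_zero]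
      exact mul_nonneg (Real.exp_pos _).le (hM j).le
    | succ d ih =>
      intro n t ht
      rw [Finset.sum_range_succ', add_zero] at ht
      set S := ∑ k ∈ Finset.range d, a (n + (k + 1)) with hS
      have hS0 : 0 ≤ S := Finset.sum_nonneg fun k _ => ha0 _
      -- Clamp `t` to `[-S, S]` and leave the rest to the last step.
      obtain ⟨t', τ, rfl, ht', hτ⟩ : ∃ t' τ, t = t' + τ ∧ |t'| ≤ S ∧ |τ| ≤ a n := by
        have h0 := ha0 n
        rw [abs_le] at ht
        refine ⟨max (-S) (min S t), t - max (-S) (min S t), by ring, ?_, ?_⟩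
        · rw [abs_le]
          exact ⟨le_max_left _ _, max_le (by linarith) (min_le_left _ _)⟩
        · rw [abs_le]
          rcases le_total S t with h1 | h1
          · rw [min_eq_left h1, max_eq_right (by linarith)]
            constructor <;> linarith
          · rw [min_eq_right h1]
            rcases le_total (-S) t with h2 | h2
            · rw [max_eq_right h2]; constructor <;> linarith
            · rw [max_eq_left h2]; constructor <;> linarith
      refine bang_step hM hanti hbound htaylor n t' τ hτ (ih (n + 1) t' (ht'.trans (le_of_eq ?_)))
      exact Finset.sum_congr rfl fun k _ => by rw [add_assoc, add_comm k 1]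
  have hsmall : ∀ n : ℕ, ‖φ 0 t‖ ≤ Real.exp (-n) * M 0 := by
    intro n
    have hdivn : ¬ Summable fun k => a (n + k) := by
      simpa only [add_comm n] using (summable_nat_add_iff n).not.2 hdiva
    have htend := (not_summable_iff_tendsto_nat_atTop_of_nonneg fun k => ha0 (n + k)).1 hdivn
    obtain ⟨d, hd⟩ := (htend.eventually_ge_atTop |t|).exists
    simpa using chain d n t hd 0
  have hlim : Filter.Tendsto (fun n : ℕ => Real.exp (-n) * M 0) Filter.atTop (nhds 0) := by
    have h := Real.tendsto_exp_neg_atTop_nhds_zero.comp (tendsto_natCast_atTop_atTop (R := ℝ))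
    simpa using h.mul_const (M 0)
  exact norm_le_zero_iff.1 (ge_of_tendsto' hlim hsmall)

/-! ### Fourier integrals with vanishing moments -/

section FourierIntegral

variable {Ω : Type*} {mΩ : MeasurableSpace Ω} {μ : Measure Ω}

theorem integrable_pow_mul_exp {X : Ω → ℝ} {g : Ω → ℂ} (hX : AEStronglyMeasurable X μ)
    (hint : ∀ k : ℕ, Integrable (fun x => (X x : ℂ) ^ k * g x) μ) (j : ℕ) (t : ℝ) :
    Integrable (fun x => (X x * Complex.I) ^ j * g x * Complex.exp (t * X x * Complex.I)) μ := by
  have hX' : AEStronglyMeasurable (fun x => (X x : ℂ)) μ :=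
    Complex.continuous_ofReal.comp_aestronglyMeasurable hX
  have hE : AEStronglyMeasurable (fun x => Complex.exp (t * X x * Complex.I)) μ :=
    Complex.continuous_exp.comp_aestronglyMeasurable ((hX'.const_mul _).mul_const _)
  have h : Integrable (fun x => (X x * Complex.I) ^ j * g x) μ := by
    refine ((hint j).const_mul (Complex.I ^ j)).congr (ae_of_all _ fun x => ?_)
    simp only [mul_pow]; ring
  refine h.mul_bdd (c := 1) hE (ae_of_all _ fun x => ?_)
  rw [← Complex.ofReal_mul, Complex.norm_exp_ofReal_mul_I]

/-- If all moments `∫ X ^ k * g` vanish, and the absolute moments are bounded by a log-convex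
sequence of Denjoy–Carleman type, then the Fourier integral `t ↦ ∫ g * exp (i t X)` is zero. -/
theorem integral_mul_exp_eq_zero {X : Ω → ℝ} {g : Ω → ℂ} (hX : AEStronglyMeasurable X μ)
    {M : ℕ → ℝ} (hM : ∀ k, 0 < M k) (hanti : Antitone fun k => M k / M (k + 1))
    (hdiv : ¬ Summable fun k => M k / M (k + 1))
    (hint : ∀ k : ℕ, Integrable (fun x => (X x : ℂ) ^ k * g x) μ)
    (hbound : ∀ k : ℕ, ∫ x, |X x| ^ k * ‖g x‖ ∂μ ≤ M k)
    (hzero : ∀ k : ℕ, ∫ x, (X x : ℂ) ^ k * g x ∂μ = 0) (t : ℝ) :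
    ∫ x, g x * Complex.exp (t * X x * Complex.I) ∂μ = 0 := by
  have hnorm : ∀ x : Ω, ∀ s : ℝ, ‖Complex.exp (s * X x * Complex.I)‖ = 1 := fun x s => by
    rw [← Complex.ofReal_mul, Complex.norm_exp_ofReal_mul_I]
  have habs : ∀ k : ℕ, Integrable (fun x => |X x| ^ k * ‖g x‖) μ := fun k =>
    (hint k).norm.congr (ae_of_all _ fun x => by simp)
  have hF := integrable_pow_mul_exp hX hint
  have h := denjoy_carleman hM hanti hdiv
    (φ := fun j t => ∫ x, (X x * Complex.I) ^ j * g x * Complex.exp (t * X x * Complex.I) ∂μ)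
    ?_ ?_ ?_ t
  · simpa using h
  · intro j t
    refine (norm_integral_le_integral_norm _).trans (le_trans (le_of_eq ?_) (hbound j))
    refine integral_congr_ae (ae_of_all _ fun x => ?_)
    simp [hnorm]
  · intro j m t τ
    simp only [← integral_const_mul]
    rw [← integral_finsetSum _ fun l _ => (hF (j + l) t).const_mul _,
      ← integral_sub (hF j _) (integrable_finsetSum _ fun l _ => (hF (j + l) t).const_mul _)]
    calc _ ≤ ∫ x, |τ| ^ m / (m.factorial : ℝ) * (|X x| ^ (j + m) * ‖g x‖) ∂μ := by
          refine norm_integral_le_of_norm_le ((habs (j + m)).const_mul _)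
            (ae_of_all _ fun x => ?_)
          have hsplit : Complex.exp (((t + τ : ℝ) : ℂ) * X x * Complex.I) =
              Complex.exp (t * X x * Complex.I) *
                Complex.exp (((τ * X x : ℝ) : ℂ) * Complex.I) := by
            rw [← Complex.exp_add]; push_cast; ring_nf
          have hfac : (X x * Complex.I) ^ j * g x * Complex.exp (((t + τ : ℝ) : ℂ) * X x * Complex.I) -
              ∑ l ∈ Finset.range m, (τ : ℂ) ^ l / (l.factorial : ℂ) *
                ((X x * Complex.I) ^ (j + l) * g x * Complex.exp (t * X x * Complex.I)) =
              (X x * Complex.I) ^ j * g x * Complex.exp (t * X x * Complex.I) *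
                (Complex.exp (((τ * X x : ℝ) : ℂ) * Complex.I) - ∑ l ∈ Finset.range m,
                  (((τ * X x : ℝ) : ℂ) * Complex.I) ^ l / (l.factorial : ℂ)) := by
            rw [hsplit, mul_sub, Finset.mul_sum]
            congr 1
            · ring
            · refine Finset.sum_congr rfl fun l _ => ?_
              push_cast
              rw [pow_add]; ring
          rw [hfac, norm_mul, norm_mul, hnorm, mul_one, norm_mul, norm_pow, norm_mul,
            Complex.norm_I, mul_one, Complex.norm_real, Real.norm_eq_abs]
          calc _ ≤ |X x| ^ j * ‖g x‖ * (|τ * X x| ^ m / (m.factorial : ℝ)) :=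
                mul_le_mul_of_nonneg_left (norm_exp_mul_I_sub_sum_le _ m) (by positivity)
            _ = _ := by rw [abs_mul, pow_add]; ring
      _ = |τ| ^ m / (m.factorial : ℝ) * ∫ x, |X x| ^ (j + m) * ‖g x‖ ∂μ := integral_const_mul _ _
      _ ≤ _ := mul_le_mul_of_nonneg_left (hbound _) (by positivity)
  · intro j
    have : ∀ x, (X x * Complex.I) ^ j * g x * Complex.exp ((0 : ℝ) * X x * Complex.I) =
        Complex.I ^ j * ((X x : ℂ) ^ j * g x) := fun x => by
      simp only [Complex.ofReal_zero, zero_mul, Complex.exp_zero]; ring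
    simp only [this, integral_const_mul, hzero, mul_zero]

theorem integral_mul_le_sqrt_mul_sqrt {u v : Ω → ℝ} (hu : MemLp u 2 μ) (hv : MemLp v 2 μ) :
    ∫ x, |u x| * |v x| ∂μ ≤ √(∫ x, u x ^ 2 ∂μ) * √(∫ x, v x ^ 2 ∂μ) := by
  have h := integral_mul_norm_le_Lp_mul_Lq (μ := μ) (f := u) (g := v) Real.HolderConjugate.two_two
    (by simpa using hu) (by simpa using hv)
  simpa [Real.sqrt_eq_rpow] using h

end FourierIntegral

/-! ### Functions orthogonal to all polynomials -/

section FiniteMoments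

variable {n : ℕ} {μ : Measure (Fin n → ℝ)}

/-- If all coordinates have finite moments, all polynomials are square integrable. -/
theorem memLp_two_eval [IsFiniteMeasure μ]
    (hm : ∀ i k, Integrable (fun x : Fin n → ℝ => x i ^ (2 * k)) μ)
    (p : MvPolynomial (Fin n) ℝ) : MemLp (fun x => MvPolynomial.eval x p) 2 μ := by
  -- Exponents that are powers of two suffice, and Hölder's inequality halves the exponent.
  have hX : ∀ i k, MemLp (fun x : Fin n → ℝ => x i) ((2 ^ (k + 1) : ℕ) : ℝ≥0∞) μ := by
    intro i k
    rw [← integrable_norm_rpow_iff (measurable_pi_apply i).aestronglyMeasurable (by simp) (ENNReal.natCast_ne_top _)]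
    refine (hm i (2 ^ k)).congr (ae_of_all _ fun x => ?_)
    beta_reduce
    rw [ENNReal.toReal_natCast, Real.rpow_natCast, Real.norm_eq_abs, pow_succ', Even.pow_abs]
    exact even_two_mul _
  have : ∀ k : ℕ, MemLp (fun x => MvPolynomial.eval x p) ((2 ^ (k + 1) : ℕ) : ℝ≥0∞) μ := by
    induction p using MvPolynomial.induction_on with
    | C a => intro k; simpa using memLp_const a
    | add p q hp hq => intro k; simpa [Pi.add_def] using (hp k).add (hq k)
    | mul_X p i hp =>
      intro k
      have : ENNReal.HolderTriple ((2 ^ (k + 1 + 1) : ℕ) : ℝ≥0∞) ((2 ^ (k + 1 + 1) : ℕ) : ℝ≥0∞)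
          ((2 ^ (k + 1) : ℕ) : ℝ≥0∞) := by
        constructor
        rw [pow_succ _ (k + 1), Nat.cast_mul, ENNReal.mul_inv (by simp) (by simp), ← mul_add]
        simp [ENNReal.inv_two_add_inv_two]
      have h := (hX i (k + 1)).mul (hp (k + 1)) (r := ((2 ^ (k + 1) : ℕ) : ℝ≥0∞))
      simpa [Pi.mul_def] using h
  simpa using this 0

/-- An integrable function `f` such that `f μ` has zero Fourier transform is zero. -/
theorem ae_eq_zero_of_forall_integral_exp_eq_zero [IsFiniteMeasure μ] {f : (Fin n → ℝ) → ℝ}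
    (hf : Integrable f μ)
    (h : ∀ t : Fin n → ℝ, ∫ x, (f x : ℂ) * Complex.exp ((∑ j, t j * x j : ℝ) * Complex.I) ∂μ = 0) :
    f =ᵐ[μ] 0 := by
  -- The positive and negative parts of `f` are densities of finite measures with the same
  -- characteristic function.
  set F : (Fin n → ℝ) → ℝ≥0∞ := fun x => ENNReal.ofReal (f x) with hF
  set G : (Fin n → ℝ) → ℝ≥0∞ := fun x => ENNReal.ofReal (-f x) with hG
  have hFm : AEMeasurable F μ := hf.aemeasurable.ennreal_ofReal
  have hGm : AEMeasurable G μ := hf.neg.aemeasurable.ennreal_ofReal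
  have hFt : ∫⁻ x, F x ∂μ ≠ ∞ := hf.lintegral_lt_top.ne
  have hGt : ∫⁻ x, G x ∂μ ≠ ∞ := hf.neg.lintegral_lt_top.ne
  have : IsFiniteMeasure (μ.withDensity F) := isFiniteMeasure_withDensity hFt
  have : IsFiniteMeasure (μ.withDensity G) := isFiniteMeasure_withDensity hGt
  have heq : μ.withDensity F = μ.withDensity G := by
    refine Measure.ext_of_charFunDual (funext fun L => ?_)
    rw [charFunDual_apply, charFunDual_apply,
      integral_withDensity_eq_integral_toReal_smul₀ hFm (ae_of_all _ fun x => ENNReal.ofReal_lt_top),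
      integral_withDensity_eq_integral_toReal_smul₀ hGm (ae_of_all _ fun x => ENNReal.ofReal_lt_top),
      ← sub_eq_zero]
    have hL : ∀ x : Fin n → ℝ, L x = ∑ j, L (Pi.single j 1) * x j := by
      intro x
      conv_lhs => rw [← Finset.univ_sum_single x, map_sum]
      refine Finset.sum_congr rfl fun j _ => ?_
      rw [show (Pi.single j (x j) : Fin n → ℝ) = x j • Pi.single j (1 : ℝ) by
        rw [← Pi.single_smul, smul_eq_mul, mul_one], map_smul, smul_eq_mul, mul_comm]
    have hb : ∀ {u : (Fin n → ℝ) → ℝ}, Integrable u μ →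
        Integrable (fun x => u x • Complex.exp (L x * Complex.I)) μ := by
      intro u hu
      refine (hu.ofReal (𝕜 := ℂ)).mul_bdd (c := 1)
        (g := fun x => Complex.exp (L x * Complex.I)) (by fun_prop) (ae_of_all _ fun x => ?_)
        |>.congr (ae_of_all _ fun x => ?_)
      · rw [Complex.norm_exp_ofReal_mul_I]
      · simp
    rw [← integral_sub (hb (integrable_toReal_of_lintegral_ne_top hFm hFt))
      (hb (integrable_toReal_of_lintegral_ne_top hGm hGt)), ← h fun j => L (Pi.single j 1)]
    refine integral_congr_ae (ae_of_all _ fun x => ?_)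
    simp only [← hL, ← sub_smul]
    rw [Complex.real_smul]
    congr 2
    simp only [hF, hG, ENNReal.toReal_ofReal']
    exact max_zero_sub_max_neg_zero_eq_self _
  filter_upwards [(withDensity_eq_iff hFm hGm hFt).1 heq] with x hx
  have hx' := congrArg ENNReal.toReal hx
  simp only [hF, hG, ENNReal.toReal_ofReal'] at hx'
  have := max_zero_sub_max_neg_zero_eq_self (f x)
  simp only [Pi.zero_apply]
  linarith

/-- The alternative into which the Carleman condition at the coordinate `i` is unfolded: either the
coordinate vanishes almost everywhere, or all its even moments are positive and the ratios of
consecutive ones have divergent sum of square roots. -/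
def CarlemanAlternative (μ : Measure (Fin n → ℝ)) (i : Fin n) : Prop :=
  (∀ᵐ x ∂μ, x i = 0) ∨
    ((∀ k, 0 < ∫ x, x i ^ (2 * k) ∂μ) ∧
      ¬ Summable fun k => √((∫ x, x i ^ (2 * k) ∂μ) / ∫ x, x i ^ (2 * (k + 1)) ∂μ))

/-- Log-convexity of the even moments. -/
theorem antitone_moment_ratio [IsFiniteMeasure μ]
    (hm : ∀ i k, Integrable (fun x : Fin n → ℝ => x i ^ (2 * k)) μ) (i : Fin n)
    (hpos : ∀ k, 0 < ∫ x, x i ^ (2 * k) ∂μ) :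
    Antitone fun k => (∫ x, x i ^ (2 * k) ∂μ) / ∫ x, x i ^ (2 * (k + 1)) ∂μ := by
  refine antitone_nat_of_succ_le fun k => ?_
  have hL : ∀ l : ℕ, MemLp (fun x : Fin n → ℝ => x i ^ l) 2 μ := fun l => by
    simpa using memLp_two_eval hm (MvPolynomial.X i ^ l)
  have h := integral_mul_le_sqrt_mul_sqrt (hL k) (hL (k + 2))
  have h1 : ∀ x : Fin n → ℝ, |x i ^ k| * |x i ^ (k + 2)| = x i ^ (2 * (k + 1)) := fun x => by
    rw [← abs_mul, ← pow_add, show k + (k + 2) = 2 * (k + 1) by ring, abs_of_nonneg]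
    exact (even_two_mul _).pow_nonneg _
  simp only [h1, ← pow_mul, mul_comm _ 2] at h
  rw [div_le_div_iff₀ (hpos _) (hpos _), ← sq]
  rw [← Real.sqrt_mul (hpos _).le] at h
  exact (Real.le_sqrt (hpos _).le (mul_pos (hpos _) (hpos _)).le).1 h

theorem integrable_mul_eval_mul_exp [IsFiniteMeasure μ]
    (hm : ∀ i k, Integrable (fun x : Fin n → ℝ => x i ^ (2 * k)) μ)
    {f : (Fin n → ℝ) → ℝ} (hf : MemLp f 2 μ) (p : MvPolynomial (Fin n) ℝ)
    (S : Finset (Fin n)) (t : Fin n → ℝ) :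
    Integrable (fun x => ((f x * MvPolynomial.eval x p : ℝ) : ℂ) *
      Complex.exp ((∑ j ∈ S, t j * x j : ℝ) * Complex.I)) μ := by
  refine ((hf.integrable_mul (memLp_two_eval hm p)).ofReal (𝕜 := ℂ)).mul_bdd (c := 1)
    (Continuous.aestronglyMeasurable (by fun_prop)) (ae_of_all _ fun x => ?_)
  rw [Complex.norm_exp_ofReal_mul_I]

/-- The polynomials are replaced by characters one coordinate at a time. In the step, the moments
`∫ x_i ^ k * f * p` are bounded by a multiple of `(∫ x_i ^ (4k)) ^ (1/4)`, by applying the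
Cauchy–Schwarz inequality twice, and this bound is again of Denjoy–Carleman type. -/
theorem integral_mul_eval_mul_exp_eq_zero [IsFiniteMeasure μ]
    (hm : ∀ i k, Integrable (fun x : Fin n → ℝ => x i ^ (2 * k)) μ)
    (hC : ∀ i, CarlemanAlternative μ i) {f : (Fin n → ℝ) → ℝ} (hf : MemLp f 2 μ)
    (horth : ∀ p : MvPolynomial (Fin n) ℝ, ∫ x, f x * MvPolynomial.eval x p ∂μ = 0)
    (t : Fin n → ℝ) (S : Finset (Fin n)) :
    ∀ p : MvPolynomial (Fin n) ℝ, ∫ x, ((f x * MvPolynomial.eval x p : ℝ) : ℂ) *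
      Complex.exp ((∑ j ∈ S, t j * x j : ℝ) * Complex.I) ∂μ = 0 := by
  induction S using Finset.induction_on with
  | empty =>
    intro p
    simp only [Finset.sum_empty, Complex.ofReal_zero, zero_mul, Complex.exp_zero, mul_one]
    rw [integral_complex_ofReal, horth, Complex.ofReal_zero]
  | insert i S hi ih =>
    intro p
    set g : (Fin n → ℝ) → ℂ := fun x => ((f x * MvPolynomial.eval x p : ℝ) : ℂ) *
      Complex.exp ((∑ j ∈ S, t j * x j : ℝ) * Complex.I) with hg
    have hsplit : ∀ x : Fin n → ℝ, ((f x * MvPolynomial.eval x p : ℝ) : ℂ) *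
        Complex.exp ((∑ j ∈ insert i S, t j * x j : ℝ) * Complex.I) =
        g x * Complex.exp (t i * x i * Complex.I) := by
      intro x
      rw [Finset.sum_insert hi, hg, mul_assoc, ← Complex.exp_add]
      push_cast
      ring_nf
    simp only [hsplit]
    rcases hC i with h0 | ⟨hpos, hdiv⟩
    · rw [← ih p]
      refine integral_congr_ae ?_
      filter_upwards [h0] with x hx
      simp [hx, hg]
    set y : ℕ → ℝ := fun k => ∫ x, x i ^ (2 * k) ∂μ with hy
    have hanti := antitone_moment_ratio hm i hpos
    have hp4 : MemLp (fun x => MvPolynomial.eval x p ^ 2) 2 μ := by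
      simp_rw [← map_pow]
      exact memLp_two_eval hm (p ^ 2)
    have hX : ∀ l : ℕ, MemLp (fun x : Fin n → ℝ => x i ^ l) 2 μ := fun l => by
      simpa using memLp_two_eval hm (MvPolynomial.X i ^ l)
    -- The summand `1` below makes the constant `A * B + 1` positive.
    set A := √(∫ x, f x ^ 2 ∂μ) with hA
    set B := √√(∫ x, (MvPolynomial.eval x p ^ 2) ^ 2 ∂μ) with hB
    have hcs : ∀ k : ℕ, ∫ x, |x i| ^ k * ‖g x‖ ∂μ ≤ (A * B + 1) * √√(y (2 * k)) := by
      intro k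
      have h1 := integral_mul_le_sqrt_mul_sqrt hf (memLp_two_eval hm (MvPolynomial.X i ^ k * p))
      have h2 := integral_mul_le_sqrt_mul_sqrt (hX (2 * k)) hp4
      have e1 : ∀ x : Fin n → ℝ, |x i| ^ k * ‖g x‖ =
          |f x| * |MvPolynomial.eval x (MvPolynomial.X i ^ k * p)| := fun x => by
        simp only [hg, norm_mul, Complex.norm_exp_ofReal_mul_I, Complex.norm_real,
          Real.norm_eq_abs, map_mul, map_pow, MvPolynomial.eval_X, abs_mul, abs_pow, mul_one]
        ring
      have e2 : ∀ x : Fin n → ℝ, MvPolynomial.eval x (MvPolynomial.X i ^ k * p) ^ 2 =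
          |x i ^ (2 * k)| * |MvPolynomial.eval x p ^ 2| := fun x => by
        simp only [map_mul, map_pow, MvPolynomial.eval_X]
        rw [← abs_mul, pow_mul', ← mul_pow, abs_of_nonneg (sq_nonneg _)]
      have e3 : ∀ x : Fin n → ℝ, (x i ^ (2 * k)) ^ 2 = x i ^ (2 * (2 * k)) := fun x => by
        rw [← pow_mul]; ring_nf
      simp only [e1]
      refine h1.trans ?_
      simp only [e2]
      simp only [e3] at h2
      have h3 := Real.sqrt_le_sqrt h2
      rw [Real.sqrt_mul (Real.sqrt_nonneg _)] at h3
      calc _ ≤ A * (√√(y (2 * k)) * B) := mul_le_mul_of_nonneg_left h3 (Real.sqrt_nonneg _)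
        _ ≤ _ := by nlinarith [Real.sqrt_nonneg √(y (2 * k))]
    have hc : 0 < A * B + 1 := by positivity
    have hratio : ∀ k, (A * B + 1) * √√(y (2 * k)) / ((A * B + 1) * √√(y (2 * (k + 1)))) =
        √√(y (2 * k)) / √√(y (2 * (k + 1))) := fun k => mul_div_mul_left _ _ hc.ne'
    have hmom : ∀ (k : ℕ) (x : Fin n → ℝ), (x i : ℂ) ^ k * g x =
        ((f x * MvPolynomial.eval x (MvPolynomial.X i ^ k * p) : ℝ) : ℂ) *
          Complex.exp ((∑ j ∈ S, t j * x j : ℝ) * Complex.I) := fun k x => by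
      simp only [hg, map_mul, map_pow, MvPolynomial.eval_X, Complex.ofReal_mul, Complex.ofReal_pow]
      ring
    refine integral_mul_exp_eq_zero (X := fun x => x i) (g := g)
      (M := fun k => (A * B + 1) * √√(y (2 * k))) (measurable_pi_apply i).aestronglyMeasurable
      (fun k => mul_pos hc (Real.sqrt_pos.2 (Real.sqrt_pos.2 (hpos _)))) ?_ ?_ ?_ hcs ?_ (t i)
    · simp only [hratio]
      exact antitone_sqrt_sqrt_ratio hpos hanti
    · simp only [hratio]
      exact not_summable_sqrt_sqrt_ratio hpos hanti hdiv
    · intro k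
      simp only [hmom]
      exact integrable_mul_eval_mul_exp hm hf _ S t
    · intro k
      simp only [hmom]
      exact ih _

end FiniteMoments

/-! ### The Carleman condition -/

section Carleman

variable {n : ℕ} {μ : Measure (Fin n → ℝ)}

theorem evenMarginalMoment_eq_zero_iff (i : Fin n) {k : ℕ} (hk : k ≠ 0) :
    evenMarginalMoment μ i k = 0 ↔ ∀ᵐ x ∂μ, x i = 0 := by
  rw [evenMarginalMoment, lintegral_eq_zero_iff (by fun_prop)]
  refine Filter.eventually_congr (ae_of_all _ fun x => ?_)
  have h := (even_two_mul k).pow_nonneg (x i)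
  rw [Pi.zero_apply, ENNReal.ofReal_eq_zero, h.ge_iff_eq', pow_eq_zero_iff (by omega)]

theorem integrable_pow_iff_evenMarginalMoment_ne_top (i : Fin n) (k : ℕ) :
    Integrable (fun x : Fin n → ℝ => x i ^ (2 * k)) μ ↔ evenMarginalMoment μ i k ≠ ∞ := by
  rw [evenMarginalMoment, lintegral_ofReal_ne_top_iff_integrable
    ((measurable_pi_apply i).pow_const _).aestronglyMeasurable
    (ae_of_all _ fun x => (even_two_mul k).pow_nonneg _)]

theorem evenMarginalMoment_ne_top_of_le [IsFiniteMeasure μ] (i : Fin n) {k l : ℕ} (hkl : k ≤ l)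
    (h : evenMarginalMoment μ i l ≠ ∞) : evenMarginalMoment μ i k ≠ ∞ := by
  rw [← integrable_pow_iff_evenMarginalMoment_ne_top] at h ⊢
  refine ((integrable_const (1 : ℝ)).add h).mono'
    ((measurable_pi_apply i).pow_const _).aestronglyMeasurable (ae_of_all _ fun x => ?_)
  have h0 := (even_two_mul k).pow_nonneg (x i)
  rw [Real.norm_eq_abs, abs_of_nonneg h0, Pi.add_apply, pow_mul, pow_mul]
  rcases le_total (x i ^ 2) 1 with h1 | h1
  · have h2 := pow_le_one₀ (n := k) (sq_nonneg (x i)) h1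
    have h3 := pow_nonneg (sq_nonneg (x i)) l
    linarith
  · have h2 := pow_le_pow_right₀ h1 hkl
    linarith

/-- Under the Carleman condition all even moments are finite: otherwise they are infinite from some
index on, so that the series has finitely many nonzero terms; these are finite unless the
coordinate vanishes almost everywhere, in which case all moments with `k ≥ 1` are zero. -/
theorem SatisfiesCarleman.integrable [IsFiniteMeasure μ] (hμ : SatisfiesCarleman μ) (i : Fin n)
    (k : ℕ) : Integrable (fun x : Fin n → ℝ => x i ^ (2 * k)) μ := by
  rw [integrable_pow_iff_evenMarginalMoment_ne_top]
  intro htop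
  have hbig : ∀ l, k ≤ l → evenMarginalMoment μ i l = ∞ := fun l hl => by
    by_contra h
    exact evenMarginalMoment_ne_top_of_le i hl h htop
  have hne : ∀ l, l ≠ 0 → evenMarginalMoment μ i l ≠ 0 := by
    intro l hl h
    rw [evenMarginalMoment_eq_zero_iff i hl,
      ← evenMarginalMoment_eq_zero_iff i (k := k + 1) (by omega)] at h
    simp [hbig (k + 1) (by omega)] at h
  have hsum := hμ i
  rw [tsum_eq_sum (s := Finset.range k)] at hsum
  · refine ENNReal.sum_ne_top.2 (fun l _ => ?_) hsum
    rw [ENNReal.rpow_neg]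
    refine ENNReal.inv_ne_top.2 fun h => ?_
    rcases ENNReal.rpow_eq_zero_iff.1 h with h | h
    · exact hne _ (by omega) h.1
    · exact absurd h.2 (not_lt.2 (by positivity))
  · intro l hl
    rw [hbig (l + 1) (by simp at hl; omega), ENNReal.top_rpow_of_neg]
    rw [neg_lt_zero]
    positivity

theorem SatisfiesCarleman.alternative [IsFiniteMeasure μ] (hμ : SatisfiesCarleman μ)
    (i : Fin n) : CarlemanAlternative μ i := by
  by_cases h0 : ∀ᵐ x ∂μ, x i = 0
  · exact Or.inl h0
  refine Or.inr ?_
  have hnn : ∀ (k : ℕ) (x : Fin n → ℝ), 0 ≤ x i ^ (2 * k) := fun k x =>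
    (even_two_mul k).pow_nonneg _
  have hofReal : ∀ k, evenMarginalMoment μ i k = ENNReal.ofReal (∫ x, x i ^ (2 * k) ∂μ) :=
    fun k => (ofReal_integral_eq_lintegral_ofReal (hμ.integrable i k)
      (ae_of_all _ (hnn k))).symm
  have hpos : ∀ k, 0 < ∫ x, x i ^ (2 * k) ∂μ := by
    intro k
    refine lt_of_le_of_ne (integral_nonneg (hnn k)) fun h => h0 ?_
    rcases Nat.eq_zero_or_pos k with rfl | hk
    · have hμ0 : μ = 0 := by
        have h' : evenMarginalMoment μ i 0 = 0 := by rw [hofReal, ← h, ENNReal.ofReal_zero]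
        simpa [evenMarginalMoment] using h'
      simp [hμ0]
    · rw [← evenMarginalMoment_eq_zero_iff i hk.ne', hofReal, ← h, ENNReal.ofReal_zero]
  refine ⟨hpos, not_summable_sqrt_ratio hpos fun hs => ?_⟩
  have hsum := hμ i
  simp only [hofReal] at hsum
  rw [tsum_congr fun k => ENNReal.ofReal_rpow_of_pos (hpos (k + 1)),
    ← ENNReal.ofReal_tsum_of_nonneg (fun k => Real.rpow_nonneg (hpos _).le _) hs] at hsum
  exact ENNReal.ofReal_ne_top hsum

/-! ### Density of the polynomials -/

/-- A square integrable function orthogonal to all polynomials vanishes almost everywhere. -/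
theorem SatisfiesCarleman.ae_eq_zero_of_orthogonal [IsFiniteMeasure μ] (hμ : SatisfiesCarleman μ)
    {f : (Fin n → ℝ) → ℝ} (hf : MemLp f 2 μ)
    (horth : ∀ p : MvPolynomial (Fin n) ℝ, ∫ x, f x * MvPolynomial.eval x p ∂μ = 0) :
    f =ᵐ[μ] 0 := by
  refine ae_eq_zero_of_forall_integral_exp_eq_zero (hf.integrable (by norm_num)) fun t => ?_
  simpa using integral_mul_eval_mul_exp_eq_zero hμ.integrable hμ.alternative hf horth t
    Finset.univ 1

/-- The classes of polynomial functions, as a subspace of `L²(μ)`. -/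
noncomputable def polynomialSubmodule (μ : Measure (Fin n → ℝ)) : Submodule ℝ (Lp ℝ 2 μ) where
  carrier := polynomialsInL2 μ
  zero_mem' := ⟨0, by simp_rw [map_zero]; exact Lp.coeFn_zero ℝ 2 μ⟩
  add_mem' := by
    rintro F G ⟨p, hp⟩ ⟨q, hq⟩
    refine ⟨p + q, ?_⟩
    filter_upwards [hp, hq, Lp.coeFn_add F G] with x h1 h2 h3
    rw [h3, Pi.add_apply, h1, h2, map_add]
  smul_mem' := by
    rintro c F ⟨p, hp⟩
    refine ⟨c • p, ?_⟩
    filter_upwards [hp, Lp.coeFn_smul c F] with x h1 h2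
    rw [h2, Pi.smul_apply, h1, smul_eq_mul, MvPolynomial.smul_eval]

theorem SatisfiesCarleman.dense_polynomialsInL2 [IsFiniteMeasure μ] (hμ : SatisfiesCarleman μ) :
    Dense (polynomialsInL2 μ) := by
  change Dense (polynomialSubmodule μ : Set (Lp ℝ 2 μ))
  rw [Submodule.dense_iff_topologicalClosure_eq_top, Submodule.topologicalClosure_eq_top_iff,
    Submodule.eq_bot_iff]
  intro F hF
  refine (Lp.eq_zero_iff_ae_eq_zero).2 (hμ.ae_eq_zero_of_orthogonal (Lp.memLp F) fun p => ?_)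
  have hp := memLp_two_eval hμ.integrable p
  have hin := (Submodule.mem_orthogonal' _ F).1 hF hp.toLp ⟨p, hp.coeFn_toLp⟩
  rw [L2.inner_def] at hin
  rw [← hin]
  refine integral_congr_ae ?_
  filter_upwards [hp.coeFn_toLp] with x hx
  rw [hx, RCLike.inner_apply, conj_trivial, mul_comm]

end Carleman

theorem mainTheorem1 (n : ℕ) (μ : Measure (Fin n → ℝ)) [IsFiniteMeasure μ]
    (hμ : SatisfiesCarleman μ) :
    (∀ p : MvPolynomial (Fin n) ℝ, MemLp (fun x => MvPolynomial.eval x p) 2 μ) ∧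
    Dense (polynomialsInL2 μ) ∧
    (∀ f : (Fin n → ℝ) → ℝ, MemLp f 2 μ → ∀ ε : ℝ, 0 < ε →
      ∃ p : MvPolynomial (Fin n) ℝ,
        eLpNorm (fun x => f x - MvPolynomial.eval x p) 2 μ < ENNReal.ofReal ε) := by
  refine ⟨memLp_two_eval hμ.integrable, hμ.dense_polynomialsInL2, fun f hf ε hε => ?_⟩
  obtain ⟨G, ⟨p, hp⟩, hG⟩ := hμ.dense_polynomialsInL2.exists_dist_lt hf.toLp hε
  refine ⟨p, ?_⟩
  rw [← ENNReal.ofReal_lt_ofReal_iff hε, ← edist_dist, Lp.edist_def] at hG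
  refine lt_of_le_of_lt (le_of_eq (eLpNorm_congr_ae ?_)) hG
  filter_upwards [hp, hf.coeFn_toLp] with x h1 h2
  rw [Pi.sub_apply, h1, h2]
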